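/- Let $A=B=\{0,1\}$, let $\rho(0,0)=\rho(1,1)=0$ and $\rho(0,1)=\rho(1,0)=\rho_{\max}>0$, and let $d\in(0,\rho_{\max}/2)$. For $n\ge 1$ and $x^n\in A^n$, $y^n\in B^n$ put $\rho_n(x^n,y^n)=\frac1n\sum_{i=1}^n\rho(x_i,y_i)$. A (deterministic) $n$-th order $d$-semifaithful code is a triple $(\phi_n,f_n,g_n)$ consisting of a quantizer $\phi_n:A^n\to B_{\phi_n}$ into a codebook $B_{\phi_n}\subset B^n$ with $\rho_n(x^n,\phi_n(x^n))\le d$ for all $x^n\in A^n$, an encoder $f_n$ from $B_{\phi_n}$ to the finite binary strings, and a decoder $g_n$ from the finite binary strings to $B_{\phi_n}$ with $g_n(f_n(y^n))=y^n$ for all $y^n\in B_{\phi_n}$. Let $\mathcal{C}_{d,npr}$ be the set of all such codes (arbitrary encoder) and $\mathcal{C}_{d,pr}$ the set of those with a prefix encoder, i.e. $f_n(y^n)$ is not a prefix of $f_n(z^n)$ whenever $y^n\neq z^n$ are in $B_{\phi_n}$. Let $l(\cdot)$ denote the length of a string, $\mathcal{P}(A)$ the set of probability distributions on $A$, and $\mathbb{E}_p$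 the expectation when $X^n$ is i.i.d. with law $p$. Let $R(p,d,\rho)$ be the rate-distortion function in nats, $$R(p,d,\rho)=\min_{Q_{B|A}}\ \sum_{j,k}p(j)\,Q_{B|A}(k|j)\ln\frac{Q_{B|A}(k|j)}{\sum_{j'}p(j')\,Q_{B|A}(k|j')},$$ where the minimum is over all conditional distributions $Q_{B|A}$ with $\sum_{j,k}p(j)Q_{B|A}(k|j)\rho(j,k)\le d$. Then $$\liminf_{n\to\infty}\ \sup_{p\in\mathcal{P}(A)}\ \inf_{(\phi_n,f_n,g_n)\in\mathcal{C}_{d,pr}}\left[\frac{\ln 2}{n}\,\mathbb{E}_p\big[l(f_n(\phi_n(X^n)))\big]-R(p,d,\rho)\right]\sqrt n>0$$ and $$\liminf_{n\to\infty}\ \sup_{p\in\mathcal{P}(A)}\ \inf_{(\phi_n,f_n,g_n)\in\mathcal{C}_{d,npr}}\left[\frac{\ln 2}{n}\,\mathbb{E}_p\big[l(f_n(\phi_n(X^n)))\big]-R(p,d,\rho)\right]\sqrt n>0.$$ -/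

import Mathlib

open Filter

namespace LossyCoding

noncomputable section

variable {A B : Type} [Fintype A] [Fintype B]

/-- The output distribution `Q(k) = ∑ j, p(j) W(k|j)` on `B` induced by the source distribution `p`
and the conditional distribution `W`. -/
def outputDist (p : stdSimplex ℝ A) (W : A → stdSimplex ℝ B) (k : B) : ℝ :=
  ∑ j, p.1 j * (W j).1 k

/-- The mutual information `I(p, W)` in nats.  Terms with `p(j) W(k|j) = 0` contribute `0`, and
`p(j) W(k|j) > 0` forces `Q(k) > 0`, so the division is harmless. -/
def mutualInfo (p : stdSimplex ℝ A) (W : A → stdSimplex ℝ B) : ℝ :=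
  ∑ j, ∑ k, p.1 j * (W j).1 k * Real.log ((W j).1 k / outputDist p W k)

/-- The expected single-letter distortion of the conditional distribution `W` under `p`. -/
def expectedDistortion (ρ : A → B → ℝ) (p : stdSimplex ℝ A) (W : A → stdSimplex ℝ B) : ℝ :=
  ∑ j, ∑ k, p.1 j * (W j).1 k * ρ j k

/-- The rate-distortion function `R(p, d, ρ)` in nats: the least mutual information over all
conditional distributions whose expected distortion is at most `d`. -/
def rateDistortion (p : stdSimplex ℝ A) (d : ℝ) (ρ : A → B → ℝ) : ℝ :=
  sInf (mutualInfo p '' {W | expectedDistortion ρ p W ≤ d})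

/-- The `n`-fold extension `ρ_n(x, y) = (1/n) ∑ i, ρ(x_i, y_i)` of a distortion measure. -/
def blockDistortion {n : ℕ} (ρ : A → B → ℝ) (x : Fin n → A) (y : Fin n → B) : ℝ :=
  (1 / (n : ℝ)) * ∑ i, ρ (x i) (y i)

/-- A deterministic `n`-th order `d`-semifaithful block code `(φ, f, g)` with an arbitrary
(not necessarily prefix) binary encoder. -/
structure SemifaithfulCode (ρ : A → B → ℝ) (d : ℝ) (n : ℕ) where
  /-- the codebook -/
  codebook : Set (Fin n → B)
  /-- the quantizer `φ` -/
  quantizer : (Fin n → A) → codebook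
  /-- the binary encoder `f` -/
  encode : codebook → List Bool
  /-- the decoder `g` -/
  decode : List Bool → codebook
  /-- the decoder inverts the encoder -/
  decode_encode : ∀ y, decode (encode y) = y
  /-- `φ` is a `d`-quantizer -/
  distortion_le : ∀ x, blockDistortion ρ x (quantizer x).1 ≤ d

/-- The encoder is a prefix code: the string of a codeword is never a prefix of the string of a
different codeword. -/
def SemifaithfulCode.IsPrefix {ρ : A → B → ℝ} {d : ℝ} {n : ℕ} (C : SemifaithfulCode ρ d n) :
    Prop :=
  ∀ y z : C.codebook, y ≠ z → ¬ C.encode y <+: C.encode z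

/-- The expected rate `(1/n) 𝔼[l(f(φ(X^n))) ln 2]` in nats per symbol, for `X^n` i.i.d. with law
`p`. -/
def SemifaithfulCode.rate {ρ : A → B → ℝ} {d : ℝ} {n : ℕ} (C : SemifaithfulCode ρ d n)
    (p : stdSimplex ℝ A) : ℝ :=
  Real.log 2 / n *
    ∑ x : Fin n → A, (∏ i, p.1 (x i)) * ((C.encode (C.quantizer x)).length : ℝ)

/-- The rate redundancy of a code with respect to the rate-distortion function. -/
def SemifaithfulCode.redundancy {ρ : A → B → ℝ} {d : ℝ} {n : ℕ} (C : SemifaithfulCode ρ d n)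
    (p : stdSimplex ℝ A) : ℝ :=
  C.rate p - rateDistortion p d ρ

/-- The Hamming-type distortion measure on `{0, 1}` with value `ρmax` off the diagonal. -/
def binaryHamming (ρmax : ℝ) (j k : Fin 2) : ℝ :=
  if j = k then 0 else ρmax

end

end LossyCoding

namespace LossyCoding

noncomputable section

/-! Put `D = d / ρmax < 1/2` and take the source Bernoulli(`D`) for every `n`. Reproducing the
all-zero word meets the distortion level on average, so the rate-distortion function is at most 0
there and the redundancy is at least the rate. A semifaithful code must however treat every word,
and the number of ones exceeds `nD` by order `√n` with non-vanishing probability; each such excess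
costs proportionally many bits. The cost is measured by exponential weights `T y x` of mean 1 that
dominate `exp (s * excess)` when `y` reproduces `x`, where `s = log ((1 - D) / D)`. Averaging them
over the codebook with weights `4 ^ (-length)`, of total at most 2 for any injective encoder, bounds
the expected length below (`log_mul_iidExp_max_le`). The order `√n` of the expected positive excess
is `sqrt_mul_le_iidExp_max`. -/

/-- The expectation of `f` under the `n`-fold product of the weights `q`. -/
def iidExp {A : Type} [Fintype A] (q : A → ℝ) (n : ℕ) (f : (Fin n → A) → ℝ) : ℝ :=
  ∑ x : Fin n → A, (∏ i, q (x i)) * f x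

/-! ### Moments of centred i.i.d. sums. -/

section Moments

variable {A : Type} [Fintype A] {q : A → ℝ} {n : ℕ}

lemma iidExp_succ (q : A → ℝ) (n : ℕ) (f : (Fin (n + 1) → A) → ℝ) :
    iidExp q (n + 1) f = ∑ a, q a * iidExp q n (fun x => f (Fin.cons a x)) := by
  unfold iidExp
  rw [← (Fin.consEquiv (fun _ : Fin (n + 1) => A)).sum_comp, Fintype.sum_prod_type]
  refine Finset.sum_congr rfl fun a _ => ?_
  rw [Finset.mul_sum]
  refine Finset.sum_congr rfl fun x _ => ?_
  simp [Fin.consEquiv, Fin.prod_univ_succ, mul_assoc]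

lemma iidExp_add (q : A → ℝ) (f g : (Fin n → A) → ℝ) :
    iidExp q n (fun x => f x + g x) = iidExp q n f + iidExp q n g := by
  simp [iidExp, mul_add, Finset.sum_add_distrib]

lemma iidExp_const_mul (q : A → ℝ) (c : ℝ) (f : (Fin n → A) → ℝ) :
    iidExp q n (fun x => c * f x) = c * iidExp q n f := by
  simp only [iidExp, Finset.mul_sum]
  exact Finset.sum_congr rfl fun x _ => by ring

lemma iidExp_mono (hq : ∀ a, 0 ≤ q a) {f g : (Fin n → A) → ℝ} (h : ∀ x, f x ≤ g x) :
    iidExp q n f ≤ iidExp q n g :=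
  Finset.sum_le_sum fun x _ =>
    mul_le_mul_of_nonneg_left (h x) (Finset.prod_nonneg fun i _ => hq (x i))

lemma iidExp_sum {ι : Type} (s : Finset ι) (f : ι → (Fin n → A) → ℝ) :
    iidExp q n (fun x => ∑ y ∈ s, f y x) = ∑ y ∈ s, iidExp q n (f y) := by
  simp only [iidExp, Finset.mul_sum]
  exact Finset.sum_comm

lemma iidExp_prod (q : A → ℝ) (g : Fin n → A → ℝ) :
    iidExp q n (fun x => ∏ i, g i (x i)) = ∏ i, ∑ a, q a * g i a := by
  classical
  simp only [iidExp, ← Finset.prod_mul_distrib]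
  rw [Finset.prod_univ_sum, Fintype.piFinset_univ]

lemma iidExp_one (hq1 : ∑ a, q a = 1) : iidExp q n (fun _ => 1) = 1 := by
  simpa [hq1] using iidExp_prod (n := n) q (fun _ _ => 1)

variable {Y : A → ℝ}

lemma iidExp_sum_eq_zero (hq1 : ∑ a, q a = 1) (hY : ∑ a, q a * Y a = 0) (n : ℕ) :
    iidExp q n (fun x => ∑ i, Y (x i)) = 0 := by
  induction n with
  | zero => simp [iidExp]
  | succ n ih =>
    have h (a : A) : iidExp q n (fun x => Y a + ∑ i, Y (x i)) = Y a := by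
      have := iidExp_const_mul (n := n) q (Y a) (fun _ => 1)
      rw [iidExp_add, ih]
      simp only [mul_one] at this
      rw [this, iidExp_one hq1]; ring
    rw [iidExp_succ]
    simp [Fin.sum_univ_succ, h, hY]

lemma iidExp_sum_sq (hq1 : ∑ a, q a = 1) (hY : ∑ a, q a * Y a = 0) (n : ℕ) :
    iidExp q n (fun x => (∑ i, Y (x i)) ^ 2) = n * ∑ a, q a * Y a ^ 2 := by
  induction n with
  | zero => simp [iidExp]
  | succ n ih =>
    have h (a : A) : iidExp q n (fun x => (Y a + ∑ i, Y (x i)) ^ 2)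
        = Y a ^ 2 + n * ∑ a, q a * Y a ^ 2 := by
      have e : (fun x : Fin n → A => (Y a + ∑ i, Y (x i)) ^ 2) = fun x =>
          (Y a ^ 2 * 1 + (2 * Y a) * ∑ i, Y (x i)) + (∑ i, Y (x i)) ^ 2 := by
        funext x; ring
      rw [e, iidExp_add, iidExp_add, iidExp_const_mul, iidExp_const_mul, ih, iidExp_one hq1,
        iidExp_sum_eq_zero hq1 hY]
      ring
    rw [iidExp_succ]
    simp only [Fin.sum_univ_succ, Fin.cons_zero, Fin.cons_succ, h, mul_add,
      Finset.sum_add_distrib, ← Finset.sum_mul, hq1]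
    push_cast
    ring

/-- Splitting off one coordinate, the terms linear in the new variable or in the old sum vanish by
centring. What is left adds at most `1 + 6n` to the fourth moment, less than `3(n+1)² - 3n²`. -/
lemma iidExp_sum_pow_four_le (hq : ∀ a, 0 ≤ q a) (hq1 : ∑ a, q a = 1)
    (hY : ∑ a, q a * Y a = 0) (hY1 : ∀ a, |Y a| ≤ 1) (n : ℕ) :
    iidExp q n (fun x => (∑ i, Y (x i)) ^ 4) ≤ 3 * (n : ℝ) ^ 2 := by
  have hsq (a : A) : Y a ^ 2 ≤ 1 := (sq_le_one_iff_abs_le_one _).2 (hY1 a)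
  have hv0 : 0 ≤ ∑ a, q a * Y a ^ 2 :=
    Finset.sum_nonneg fun a _ => mul_nonneg (hq a) (sq_nonneg _)
  have hv1 : ∑ a, q a * Y a ^ 2 ≤ 1 := hq1 ▸
    Finset.sum_le_sum fun a _ => mul_le_of_le_one_right (hq a) (hsq a)
  have h4 : ∑ a, q a * Y a ^ 4 ≤ 1 := hq1 ▸
    Finset.sum_le_sum fun a _ => mul_le_of_le_one_right (hq a) (by nlinarith [hsq a, sq_nonneg (Y a)])
  induction n with
  | zero => simp [iidExp]
  | succ n ih =>
    set M3 := iidExp q n (fun x => (∑ i, Y (x i)) ^ 3)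
    set M4 := iidExp q n (fun x => (∑ i, Y (x i)) ^ 4)
    set v := ∑ a, q a * Y a ^ 2
    have h (a : A) : iidExp q n (fun x => (Y a + ∑ i, Y (x i)) ^ 4)
        = Y a ^ 4 + Y a ^ 2 * (6 * (n * v)) + Y a * (4 * M3) + M4 := by
      have e : (fun x : Fin n → A => (Y a + ∑ i, Y (x i)) ^ 4) = fun x =>
          (((Y a ^ 4 * 1 + (4 * Y a ^ 3) * ∑ i, Y (x i)) + (6 * Y a ^ 2) * (∑ i, Y (x i)) ^ 2)
            + (4 * Y a) * (∑ i, Y (x i)) ^ 3) + (∑ i, Y (x i)) ^ 4 := by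
        funext x; ring
      rw [e, iidExp_add, iidExp_add, iidExp_add, iidExp_add, iidExp_const_mul, iidExp_const_mul,
        iidExp_const_mul, iidExp_const_mul, iidExp_one hq1, iidExp_sum_eq_zero hq1 hY,
        iidExp_sum_sq hq1 hY]
      ring
    rw [iidExp_succ]
    simp only [Fin.sum_univ_succ, Fin.cons_zero, Fin.cons_succ, h, mul_add,
      Finset.sum_add_distrib, ← Finset.sum_mul, ← mul_assoc, hq1, hY]
    have hn : (0 : ℝ) ≤ n := n.cast_nonneg
    have hvv : v * v ≤ 1 := mul_le_one₀ hv1 hv0 hv1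
    have hnv := mul_le_mul_of_nonneg_left hvv hn
    push_cast
    change (∑ a, q a * Y a ^ 4) + v * 6 * n * v + 0 * 4 * M3 + 1 * M4 ≤ _
    nlinarith

/-- A fourth-moment lower bound for the expected positive part of a centred i.i.d. sum. -/
lemma sqrt_mul_le_iidExp_max (hq : ∀ a, 0 ≤ q a) (hq1 : ∑ a, q a = 1)
    (hY : ∑ a, q a * Y a = 0) (hY1 : ∀ a, |Y a| ≤ 1) {v : ℝ} (hv : ∑ a, q a * Y a ^ 2 = v)
    (hv0 : 0 ≤ v) (hv4 : v ≤ 1 / 4) (n : ℕ) :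
    v ^ 2 / 8 * √n ≤ iidExp q n (fun x => max (∑ i, Y (x i)) 0) := by
  rcases n.eq_zero_or_pos with rfl | hn
  · simp [iidExp]
  have hr : 0 < √(n : ℝ) := Real.sqrt_pos.2 (by exact_mod_cast hn)
  set r := √(n : ℝ) with hr_def
  have hr2 : r ^ 2 = n := Real.sq_sqrt n.cast_nonneg
  -- A polynomial minorant of the positive part turns the claim into second and fourth moments: with
  -- `w = v|z|/r`, it is `w - w³ ≤ 1` multiplied by `|z|/2`. The scale `v/r` lets the quadratic gain
  -- `v²r/2` beat the quartic loss `3v³r/2` for `v ≤ 1/4`.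
  have key (z : ℝ) : z / 2 + (v / (2 * r)) * z ^ 2 + (-(v ^ 3 / (2 * r ^ 3))) * z ^ 4
      ≤ max z 0 := by
    have hm : max z 0 = z / 2 + |z| / 2 := by
      rcases le_total z 0 with h | h
      · rw [max_eq_right h, abs_of_nonpos h]; ring
      · rw [max_eq_left h, abs_of_nonneg h]; ring
    rw [hm]
    have hw : 0 ≤ v * |z| / r := by positivity
    set w := v * |z| / r
    have h1 : w - w ^ 3 ≤ 1 := by nlinarith [sq_nonneg (w - 1), mul_nonneg hw (sq_nonneg (w - 1))]
    have h2 : (v / (2 * r)) * z ^ 2 + (-(v ^ 3 / (2 * r ^ 3))) * z ^ 4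
        = |z| / 2 * (w - w ^ 3) := by
      have e4 : z ^ 4 = |z| ^ 4 := by rw [← abs_pow, abs_of_nonneg (by positivity)]
      rw [← sq_abs z, e4]
      simp only [w]
      field_simp
      ring
    nlinarith [mul_le_mul_of_nonneg_left h1 (by positivity : 0 ≤ |z| / 2)]
  have hE := iidExp_mono (n := n) hq fun x => key (∑ i, Y (x i))
  refine le_trans ?_ hE
  have e : (fun x : Fin n → A => (∑ i, Y (x i)) / 2) = fun x => (1 / 2) * ∑ i, Y (x i) := by
    funext x; ring
  rw [iidExp_add, iidExp_add, iidExp_const_mul, iidExp_const_mul, e, iidExp_const_mul,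
    iidExp_sum_eq_zero hq1 hY, iidExp_sum_sq hq1 hY, hv, ← hr2]
  have h4 := iidExp_sum_pow_four_le hq hq1 hY hY1 n
  rw [← hr2] at h4
  have h5 := mul_le_mul_of_nonneg_left h4 (by positivity : 0 ≤ v ^ 3 / (2 * r ^ 3))
  have e1 : v / (2 * r) * (r ^ 2 * v) = v ^ 2 / 2 * r := by field_simp
  have e2 : v ^ 3 / (2 * r ^ 3) * (3 * (r ^ 2) ^ 2) = v * (v ^ 2 * r) * (3 / 2) := by field_simp
  rw [e2] at h5
  rw [e1]
  nlinarith [mul_le_mul_of_nonneg_right hv4 (by positivity : 0 ≤ v ^ 2 * r)]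

end Moments

/-! ### Length lower bound by exponential tilting. -/

/-- A substitute for Kraft's inequality without the prefix condition: there are at most `2 ^ k`
strings of length `k`, so base 4 leaves a geometric series of ratio 1/2. -/
lemma sum_quarter_pow_length_le_two (S : Finset (List Bool)) :
    ∑ l ∈ S, (1 / 4 : ℝ) ^ l.length ≤ 2 := by
  obtain ⟨N, hN⟩ : ∃ N, ∀ l ∈ S, l.length < N :=
    ⟨S.sup List.length + 1, fun l hl => Nat.lt_succ_of_le (Finset.le_sup (f := List.length) hl)⟩
  rw [← Finset.sum_fiberwise_of_maps_to (t := Finset.range N) (g := List.length)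
    (fun l hl => Finset.mem_range.2 (hN l hl))]
  have hcard (k : ℕ) : (S.filter fun l => l.length = k).card ≤ 2 ^ k := by
    have h := Finset.card_le_card_of_injOn (s := S.filter fun l => l.length = k)
      (t := (Finset.univ : Finset (Fin k → Bool)).image List.ofFn) id
      (fun l hl => by
        obtain rfl : l.length = k := (Finset.mem_filter.1 hl).2
        exact Finset.mem_image.2 ⟨l.get, Finset.mem_univ _, List.ofFn_get l⟩)
      (fun _ _ _ _ h => h)
    refine h.trans (Finset.card_image_le.trans ?_)
    simp
  calc ∑ k ∈ Finset.range N, ∑ l ∈ S with l.length = k, (1 / 4 : ℝ) ^ l.length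
      ≤ ∑ k ∈ Finset.range N, (1 / 2 : ℝ) ^ k := by
        refine Finset.sum_le_sum fun k _ => ?_
        rw [Finset.sum_congr rfl (g := fun _ => (1 / 4 : ℝ) ^ k)
          (fun l hl => by rw [(Finset.mem_filter.1 hl).2]), Finset.sum_const, nsmul_eq_mul]
        have h2 : ((S.filter fun l => l.length = k).card : ℝ) ≤ 2 ^ k := by
          exact_mod_cast hcard k
        calc _ ≤ (2 : ℝ) ^ k * (1 / 4) ^ k := by gcongr
          _ = (1 / 2) ^ k := by rw [← mul_pow]; norm_num
    _ ≤ 2 := sum_geometric_two_le N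

/-- The weights of the Bernoulli law with success probability `D`. -/
def bernoulliWeight (D : ℝ) (a : Fin 2) : ℝ := if a = 1 then D else 1 - D

/-- The centred Bernoulli variable. -/
def bernoulliCentred (D : ℝ) (a : Fin 2) : ℝ := if a = 1 then 1 - D else -D

/-- The Bernoulli law as a point of the simplex. -/
def bernoulliLaw (D : ℝ) (h0 : 0 ≤ D) (h1 : D ≤ 1) : stdSimplex ℝ (Fin 2) :=
  ⟨bernoulliWeight D, fun a => by
    unfold bernoulliWeight; split_ifs <;> linarith, by simp [bernoulliWeight]⟩

/-- The exponential tilt under which every codeword has the same weight. -/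
lemma iidExp_exp_tilt {D : ℝ} (h0 : 0 < D) (h1 : D < 1) {n : ℕ} (y : Fin n → Fin 2) :
    iidExp (bernoulliWeight D) n (fun x => Real.exp (∑ i, Real.log ((1 - D) / D) *
      ((if x i = 1 then 1 else 0) - (if x i = y i then 0 else 1)))) = 1 := by
  simp only [Real.exp_sum]
  rw [iidExp_prod _ (fun i a => Real.exp (Real.log ((1 - D) / D) *
      ((if a = 1 then 1 else 0) - (if a = y i then 0 else 1))))]
  -- Each factor has mean 1: it is constant when `y i = 0`, and when `y i = 1` it is the likelihood
  -- ratio of Bernoulli(`1 - D`) to Bernoulli(`D`).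
  refine Finset.prod_eq_one fun i _ => ?_
  have hD : 0 < (1 - D) / D := div_pos (by linarith) h0
  have hD' : 1 - D ≠ 0 := by linarith
  generalize y i = b
  fin_cases b
  · simp [bernoulliWeight]
  · simp [bernoulliWeight, Real.exp_neg, Real.exp_log hD]
    field_simp
    ring

lemma log_mul_iidExp_max_le {ρmax d : ℝ} (hρ : 0 < ρmax) (hd : 0 < d) (hd' : d < ρmax / 2)
    {n : ℕ} (hn : 0 < n) (C : SemifaithfulCode (binaryHamming ρmax) d n) :
    Real.log ((1 - d / ρmax) / (d / ρmax)) *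
        iidExp (bernoulliWeight (d / ρmax)) n
          (fun x => max (∑ i, bernoulliCentred (d / ρmax) (x i)) 0) ≤
      2 * (Real.log 2 * iidExp (bernoulliWeight (d / ρmax)) n
        (fun x => ((C.encode (C.quantizer x)).length : ℝ))) + 2 := by
  classical
  set D := d / ρmax with hD
  have h0 : 0 < D := by positivity
  have h2 : D < 1 / 2 := by rw [hD, div_lt_iff₀ hρ]; linarith
  have hq : ∀ a, 0 ≤ bernoulliWeight D a := (bernoulliLaw D h0.le (by linarith)).2.1
  have hq1 : ∑ a, bernoulliWeight D a = 1 := (bernoulliLaw D h0.le (by linarith)).2.2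
  have hs : 0 ≤ Real.log ((1 - D) / D) :=
    Real.log_nonneg ((one_le_div h0).2 (by linarith))
  set s := Real.log ((1 - D) / D) with hs_def
  set T : (Fin n → Fin 2) → (Fin n → Fin 2) → ℝ := fun y x =>
    Real.exp (∑ i, s * ((if x i = 1 then 1 else 0) - (if x i = y i then 0 else 1))) with hT
  have hlen (k : ℕ) : Real.exp (-(2 * (Real.log 2 * k))) = (1 / 4 : ℝ) ^ k := by
    have : -(2 * (Real.log 2 * k)) = k * Real.log (1 / 4) := by
      rw [show (1 / 4 : ℝ) = (2 ^ 2)⁻¹ by norm_num, Real.log_inv, Real.log_pow]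
      push_cast; ring
    rw [this, mul_comm, ← Real.rpow_def_of_pos (by norm_num), Real.rpow_natCast]
  -- The pointwise distortion constraint enters here: `x` differs from its codeword in at most `nD`
  -- places.
  have hcover (x : Fin n → Fin 2) :
      Real.exp (s * ∑ i, bernoulliCentred D (x i)) ≤ T (C.quantizer x).1 x := by
    rw [hT]
    refine Real.exp_le_exp.2 ?_
    rw [← Finset.mul_sum]
    refine mul_le_mul_of_nonneg_left ?_ hs
    have hdist := C.distortion_le x
    have hn' : (0 : ℝ) < n := by exact_mod_cast hn
    have e1 : ∑ i, binaryHamming ρmax (x i) ((C.quantizer x).1 i)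
        = ρmax * ∑ i, (if x i = (C.quantizer x).1 i then 0 else 1) := by
      rw [Finset.mul_sum]
      exact Finset.sum_congr rfl fun i _ => by unfold binaryHamming; split_ifs <;> simp
    have e2 : ∑ i, bernoulliCentred D (x i) = (∑ i, if x i = 1 then (1 : ℝ) else 0) - n * D := by
      rw [show (n : ℝ) * D = ∑ _i : Fin n, D by simp, ← Finset.sum_sub_distrib]
      exact Finset.sum_congr rfl fun i _ => by unfold bernoulliCentred; split_ifs <;> simp
    rw [blockDistortion, e1, one_div, inv_mul_le_iff₀ hn'] at hdist
    have : ∑ i, (if x i = (C.quantizer x).1 i then (0 : ℝ) else 1) ≤ n * D := by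
      rw [hD, ← mul_div_assoc, le_div_iff₀ hρ]; linarith
    rw [e2, Finset.sum_sub_distrib]
    linarith
  -- Keep only the term of the codeword of `x`, then use `u + 1 ≤ exp u` if the excess is
  -- nonnegative; otherwise the left side is already nonpositive.
  have hpt (x : Fin n → Fin 2) :
      s * max (∑ i, bernoulliCentred D (x i)) 0 +
        (-(2 * Real.log 2)) * ((C.encode (C.quantizer x)).length : ℝ) ≤
      ∑ y : C.codebook, (1 / 4 : ℝ) ^ (C.encode y).length * T y.1 x := by
    set k := (C.encode (C.quantizer x)).length with hk
    have hsum : (1 / 4 : ℝ) ^ k * T (C.quantizer x).1 x ≤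
        ∑ y : C.codebook, (1 / 4 : ℝ) ^ (C.encode y).length * T y.1 x :=
      Finset.single_le_sum
        (f := fun y : C.codebook => (1 / 4 : ℝ) ^ (C.encode y).length * T y.1 x)
        (fun y _ => by simp only [hT]; positivity) (Finset.mem_univ (C.quantizer x))
    refine le_trans ?_ hsum
    refine le_trans ?_ (mul_le_mul_of_nonneg_left (hcover x) (by positivity))
    rw [← hlen k, ← Real.exp_add]
    have hk0 : 0 ≤ Real.log 2 * k := by positivity
    rcases le_total (∑ i, bernoulliCentred D (x i)) 0 with h | h
    · rw [max_eq_right h]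
      have := Real.exp_pos (-(2 * (Real.log 2 * k)) + s * ∑ i, bernoulliCentred D (x i))
      linarith
    · rw [max_eq_left h]
      have := Real.add_one_le_exp (-(2 * (Real.log 2 * k)) + s * ∑ i, bernoulliCentred D (x i))
      linarith
  have hE := iidExp_mono (n := n) hq hpt
  rw [iidExp_add, iidExp_const_mul, iidExp_const_mul, iidExp_sum] at hE
  have hT1 (y : C.codebook) : iidExp (bernoulliWeight D) n
      (fun x => (1 / 4 : ℝ) ^ (C.encode y).length * T y.1 x) = (1 / 4 : ℝ) ^ (C.encode y).length := by
    rw [iidExp_const_mul, hT, iidExp_exp_tilt h0 (by linarith), mul_one]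
  have hkraft : ∑ y : C.codebook, (1 / 4 : ℝ) ^ (C.encode y).length ≤ 2 := by
    have hinj : Function.Injective C.encode := Function.LeftInverse.injective C.decode_encode
    rw [← Finset.sum_image (f := fun l : List Bool => (1 / 4 : ℝ) ^ l.length)
      (fun a _ b _ h => hinj h)]
    exact sum_quarter_pow_length_le_two _
  simp only [hT1] at hE
  linarith

/-! ### Redundancy at the critical Bernoulli law. -/

lemma rateDistortion_bernoulliLaw_nonpos {ρmax d : ℝ} (hρ : 0 < ρmax) (h0 : 0 ≤ d / ρmax)
    (h1 : d / ρmax ≤ 1) :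
    rateDistortion (bernoulliLaw (d / ρmax) h0 h1) d (binaryHamming ρmax) ≤ 0 := by
  set W : Fin 2 → stdSimplex ℝ (Fin 2) := fun _ => bernoulliLaw 0 le_rfl zero_le_one with hW
  have hI : mutualInfo (bernoulliLaw (d / ρmax) h0 h1) W = 0 := by
    simp [mutualInfo, outputDist, hW, bernoulliLaw, bernoulliWeight]
  have hD : expectedDistortion (binaryHamming ρmax) (bernoulliLaw (d / ρmax) h0 h1) W ≤ d := by
    simp [expectedDistortion, hW, bernoulliLaw, bernoulliWeight, binaryHamming,
      div_mul_cancel₀ _ hρ.ne']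
  by_cases hb : BddBelow (mutualInfo (bernoulliLaw (d / ρmax) h0 h1) ''
      {W | expectedDistortion (binaryHamming ρmax) (bernoulliLaw (d / ρmax) h0 h1) W ≤ d})
  · exact csInf_le hb ⟨W, hD, hI⟩
  -- An infimum of a set unbounded below is 0 by convention, so nonnegativity of mutual information
  -- need not be proved.
  · exact (Real.sInf_of_not_bddBelow hb).le

/-- At the Bernoulli law whose parameter is the normalized distortion level, the redundancy of every
code, prefix or not, is at least of order `1 / √n`. -/
lemma exists_const_le_redundancy_mul_sqrt {ρmax d : ℝ} (hρ : 0 < ρmax) (hd : 0 < d)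
    (hd' : d < ρmax / 2) :
    ∃ p : stdSimplex ℝ (Fin 2), ∃ c : ℝ, 0 < c ∧ ∀ᶠ n : ℕ in atTop,
      ∀ C : SemifaithfulCode (binaryHamming ρmax) d n, c ≤ C.redundancy p * √(n : ℝ) := by
  have h0 : 0 < d / ρmax := by positivity
  have h2 : d / ρmax < 1 / 2 := by rw [div_lt_iff₀ hρ]; linarith
  have h1 : d / ρmax ≤ 1 := by linarith
  have hR := rateDistortion_bernoulliLaw_nonpos hρ h0.le h1
  have hmain {n : ℕ} (hn : 0 < n) (C : SemifaithfulCode (binaryHamming ρmax) d n) :=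
    log_mul_iidExp_max_le hρ hd hd' hn C
  set D := d / ρmax
  have hs : 0 < Real.log ((1 - D) / D) := Real.log_pos ((one_lt_div h0).2 (by linarith))
  set s := Real.log ((1 - D) / D)
  set v := D * (1 - D) with hv_def
  have hv : 0 < v := mul_pos h0 (by linarith)
  have hv4 : v ≤ 1 / 4 := by nlinarith [sq_nonneg (D - 1 / 2)]
  -- The two main bounds give `L ≥ s v² √n / 16 - 1`; half of the main term absorbs the 1 once `√n ≥
  -- 32 / (s v²)`.
  refine ⟨bernoulliLaw D h0.le h1, s * v ^ 2 / 32, by positivity, ?_⟩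
  have hlim : Tendsto (fun n : ℕ => √(n : ℝ)) atTop atTop :=
    Real.tendsto_sqrt_atTop.comp tendsto_natCast_atTop_atTop
  filter_upwards [hlim.eventually_ge_atTop (32 / (s * v ^ 2)), eventually_gt_atTop 0]
    with n hnr hn C
  have hpos := sqrt_mul_le_iidExp_max (bernoulliLaw D h0.le h1).2.1 (bernoulliLaw D h0.le h1).2.2
    (Y := bernoulliCentred D) (v := v)
    (by simp [bernoulliLaw, bernoulliWeight, bernoulliCentred]; ring)
    (by intro a; unfold bernoulliCentred; rw [abs_le]; split_ifs <;> constructor <;> linarith)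
    (by simp [bernoulliLaw, bernoulliWeight, bernoulliCentred, hv_def]; ring) hv.le hv4 n
  have hm := hmain hn C
  have hp : (bernoulliLaw D h0.le h1).1 = bernoulliWeight D := rfl
  rw [hp] at hpos
  set L := Real.log 2 * iidExp (bernoulliWeight D) n
    (fun x => ((C.encode (C.quantizer x)).length : ℝ)) with hL
  have hr : 0 < √(n : ℝ) := Real.sqrt_pos.2 (by exact_mod_cast hn)
  have hrate : C.rate (bernoulliLaw D h0.le h1) * √(n : ℝ) = L / √(n : ℝ) := by
    have : C.rate (bernoulliLaw D h0.le h1) = L / n := by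
      rw [hL, iidExp, SemifaithfulCode.rate, hp]; ring
    rw [this]
    nth_rewrite 1 [← Real.sq_sqrt (n.cast_nonneg : (0 : ℝ) ≤ n)]
    field_simp
  have hle : L / √(n : ℝ) ≤ C.redundancy (bernoulliLaw D h0.le h1) * √(n : ℝ) := by
    rw [← hrate, SemifaithfulCode.redundancy]
    exact mul_le_mul_of_nonneg_right (by linarith) hr.le
  refine le_trans ((le_div_iff₀ hr).2 ?_) hle
  rw [div_le_iff₀ (by positivity)] at hnr
  nlinarith [mul_le_mul_of_nonneg_left hpos hs.le]

end

end LossyCoding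

theorem corollary5 (ρmax d : ℝ) (hρ : 0 < ρmax) (hd : 0 < d) (hd' : d < ρmax / 2) :
    (0 : EReal) < liminf (fun n : ℕ =>
        ⨆ p : stdSimplex ℝ (Fin 2),
          ⨅ C : {C : LossyCoding.SemifaithfulCode (LossyCoding.binaryHamming ρmax) d n //
              C.IsPrefix},
            ((C.1.redundancy p * √(n : ℝ) : ℝ) : EReal)) atTop ∧
    (0 : EReal) < liminf (fun n : ℕ =>
        ⨆ p : stdSimplex ℝ (Fin 2),
          ⨅ C : LossyCoding.SemifaithfulCode (LossyCoding.binaryHamming ρmax) d n,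
            ((C.redundancy p * √(n : ℝ) : ℝ) : EReal)) atTop := by
  obtain ⟨p, c, hc, h⟩ := LossyCoding.exists_const_le_redundancy_mul_sqrt hρ hd hd'
  have hc' : (0 : EReal) < (c : EReal) := EReal.coe_pos.2 hc
  refine ⟨hc'.trans_le (le_liminf_of_le (by isBoundedDefault) ?_),
    hc'.trans_le (le_liminf_of_le (by isBoundedDefault) ?_)⟩
  · filter_upwards [h] with n hn
    -- The bound holds for all encoders, so prefix codes inherit it.
    exact le_iSup_of_le p (le_iInf fun C => EReal.coe_le_coe_iff.2 (hn C.1))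
  · filter_upwards [h] with n hn
    exact le_iSup_of_le p (le_iInf fun C => EReal.coe_le_coe_iff.2 (hn C))
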